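/- Let $G$ be a locally compact, second countable Hausdorff topological group with identity $e$, and let $H_R$, $H_S$ be separable complex Hilbert spaces. Let $U_R$, $U_S$ be (possibly projective) unitary representations of $G$ on $H_R$, $H_S$: $U(gh)=c(g,h)\,U(g)U(h)$ with $|c(g,h)|=1$, and $g\mapsto|\langle\xi,U(g)\eta\rangle|$ is continuous for all vectors $\xi,\eta$ (strongly continuous unitary representations are the special case $c\equiv 1$). For a bounded operator $A$ on $H_S$ put $g.A=U_S(g)AU_S(g)^*$, and similarly on $H_R$ with $U_R$. Let $R$ be a principal frame, that is, a positive operator-valued measure $E$ on the Borel sets of $G$ acting on $H_R$ (for every state $\omega$, a positive trace-class operator of trace one, $\mu_\omega(X)=\operatorname{tr}[\omega E(X)]$ is a probability measure) with $E(gX)=U_R(g)E(X)U_R(g)^*$ for all $g\in G$ and Borel $X$. Assume that $R$ is localizable: for every Borel set $X$ with $E(X)\neq0$ and every $\varepsilon>0$ there is a unit vector $\xi\in H_R$ with $\langle\xi,E(X)\xi\rangle>1-\varepsilon$. Let $(\omega_n)_{n\in\mathbb N}$ be a localizing sequence centred at $e$: a sequence of pure states $\omega_n=|\xi_n\rangle\langle\xi_n|$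 of $H_R$ such that the probability measures $\mu_{\omega_n}$ converge weakly to the Dirac measure $\delta_e$. The relativization map is $\yen^R(A)=\int_G dE(g)\otimes g.A$, the bounded operator on $H_R\otimes H_S$ with $$\langle\xi\otimes\eta,\,\yen^R(A)(\xi\otimes\eta')\rangle=\int_G\langle\eta,(g.A)\eta'\rangle\,d\mu_{\xi}(g),\qquad \mu_\xi(X)=\langle\xi,E(X)\xi\rangle,$$ for all unit vectors $\xi\in H_R$ and all $\eta,\eta'\in H_S$. For a state $\omega$ of $H_R$ let $\Gamma_\omega:B(H_R\otimes H_S)\to B(H_S)$ be the restriction map, $\Gamma_\omega(A_R\otimes A_S)=\operatorname{tr}[\omega A_R]\,A_S$ (extended ultraweakly continuously), and put $\yen^R_\omega=\Gamma_\omega\circ\yen^R:B(H_S)\to B(H_S)$. Let $\mathcal T(H_S)$ be the space of trace-class operators on $H_S$. Then: 1. For every $A\in B(H_S)$, $\yen^R_{\omega_n}(A)\to A$ ultraweakly, i.e. $\operatorname{tr}[\Omega\,\yen^R_{\omega_n}(A)]\to\operatorname{tr}[\Omega A]$ for every $\Omega\in\mathcal T(H_S)$. 2. Equivalently, in terms of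 predual maps: for every $n$ there is exactly one map $(\yen^R_{\omega_n})_*:\mathcal T(H_S)\to\mathcal T(H_S)$ with $\operatorname{tr}[(\yen^R_{\omega_n})_*(\Omega)A]=\operatorname{tr}[\Omega\,\yen^R_{\omega_n}(A)]$ for all $\Omega\in\mathcal T(H_S)$ and $A\in B(H_S)$, and for every $\Omega\in\mathcal T(H_S)$ one has $(\yen^R_{\omega_n})_*(\Omega)\to\Omega$ in the operational topology, i.e. $\operatorname{tr}[(\yen^R_{\omega_n})_*(\Omega)A]\to\operatorname{tr}[\Omega A]$ for every $A\in B(H_S)$. -/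

import Mathlib

open scoped InnerProductSpace TensorProduct Topology NNReal
open MeasureTheory Filter

noncomputable section

namespace QRF

section TraceClass

variable (H : Type*) [NormedAddCommGroup H] [InnerProductSpace ℂ H] [CompleteSpace H]

/-- The index set of a fixed orthonormal (Hilbert) basis of `H`. -/
def basisIndex : Set H := (exists_hilbertBasis ℂ H).choose

/-- A fixed orthonormal (Hilbert) basis of `H`. -/
def basis : HilbertBasis (basisIndex H) ℂ H := (exists_hilbertBasis ℂ H).choose_spec.choose

variable {H}

/-- `T` is trace class: the positive operator `|T| = √(T* T)` has finite trace
(the sum does not depend on the orthonormal basis, as its terms are nonnegative). -/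
def IsTraceClass (T : H →L[ℂ] H) : Prop :=
  Summable fun i : basisIndex H => ⟪basis H i, CFC.abs T (basis H i)⟫_ℂ

/-- The trace `∑ᵢ ⟨eᵢ, T eᵢ⟩`; meaningful for trace-class `T`, where the sum converges absolutely
and does not depend on the orthonormal basis. -/
def trace (T : H →L[ℂ] H) : ℂ :=
  ∑' i : basisIndex H, ⟪basis H i, T (basis H i)⟫_ℂ

/-- The rank-one operator `|ξ⟩⟨ξ|`. -/
def ketbra (ξ : H) : H →L[ℂ] H := InnerProductSpace.rankOne ℂ ξ ξ

lemma ketbra_nonneg (ξ : H) : 0 ≤ ketbra ξ := by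
  rw [ContinuousLinearMap.nonneg_iff_isPositive]
  exact InnerProductSpace.isPositive_rankOne_self ξ

/-- `tr[|ξ⟩⟨ξ| T] = ⟨ξ, T ξ⟩`. -/
lemma hasSum_ketbra_mul (ξ : H) (T : H →L[ℂ] H) :
    HasSum (fun i : basisIndex H => ⟪basis H i, (ketbra ξ * T) (basis H i)⟫_ℂ) ⟪ξ, T ξ⟫_ℂ := by
  have h := (basis H).hasSum_inner_mul_inner (T.adjoint ξ) ξ
  rw [ContinuousLinearMap.adjoint_inner_left] at h
  refine h.congr_fun ?_ |> fun h => h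
  intro i
  simp [ketbra, ContinuousLinearMap.adjoint_inner_left]

lemma trace_ketbra_mul (ξ : H) (T : H →L[ℂ] H) : trace (ketbra ξ * T) = ⟪ξ, T ξ⟫_ℂ :=
  (hasSum_ketbra_mul ξ T).tsum_eq

lemma isTraceClass_ketbra (ξ : H) : IsTraceClass (ketbra ξ) := by
  have h := (hasSum_ketbra_mul ξ 1).summable
  rw [mul_one] at h
  rw [IsTraceClass, CFC.abs_of_nonneg _ (ketbra_nonneg ξ)]
  exact h

variable (H)

/-- The space `𝒯(H)` of trace-class operators on `H`. -/
def TraceClass : Type _ := {T : H →L[ℂ] H // IsTraceClass T}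

/-- The states of `H`: density operators, that is, positive trace-class operators of trace one. -/
structure DensityOperator where
  op : H →L[ℂ] H
  nonneg : 0 ≤ op
  isTraceClass : IsTraceClass op
  trace_eq_one : trace op = 1

variable {H}

/-- The pure state `|ξ⟩⟨ξ|` of a unit vector `ξ`. -/
def pureState (ξ : H) (hξ : ‖ξ‖ = 1) : DensityOperator H where
  op := ketbra ξ
  nonneg := ketbra_nonneg ξ
  isTraceClass := isTraceClass_ketbra ξ
  trace_eq_one := by
    have h := trace_ketbra_mul ξ 1
    rw [mul_one] at h
    simp [h, hξ, inner_self_eq_norm_sq_to_K]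

/-- A state is pure if it is `|ξ⟩⟨ξ|` for a unit vector `ξ`. -/
def DensityOperator.IsPure (ρ : DensityOperator H) : Prop :=
  ∃ (ξ : H) (hξ : ‖ξ‖ = 1), ρ = pureState ξ hξ

/-- Ultraweak convergence of a sequence of bounded operators. -/
def UltraweakTendsto (A : ℕ → H →L[ℂ] H) (B : H →L[ℂ] H) : Prop :=
  ∀ Ω : TraceClass H, Tendsto (fun n => trace (Ω.1 * A n)) atTop (𝓝 (trace (Ω.1 * B)))

/-- Convergence of a sequence of trace-class operators in the operational topology, the topology
of pointwise convergence of `Ω ↦ tr[Ω A]` over all bounded operators `A`. -/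
def OperationalTendsto (Ω : ℕ → TraceClass H) (Θ : TraceClass H) : Prop :=
  ∀ A : H →L[ℂ] H, Tendsto (fun n => trace ((Ω n).1 * A)) atTop (𝓝 (trace (Θ.1 * A)))

/-- `Ψ : 𝒯(H₂) → 𝒯(H₁)` is the predual map of `Φ : B(H₁) → B(H₂)`:
`tr[Ψ(Ω) A] = tr[Ω Φ(A)]` for all `Ω` and `A`. -/
def IsPredual {H₁ H₂ : Type*} [NormedAddCommGroup H₁] [InnerProductSpace ℂ H₁] [CompleteSpace H₁]
    [NormedAddCommGroup H₂] [InnerProductSpace ℂ H₂] [CompleteSpace H₂]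
    (Φ : (H₁ →L[ℂ] H₁) → (H₂ →L[ℂ] H₂)) (Ψ : TraceClass H₂ → TraceClass H₁) : Prop :=
  ∀ (Ω : TraceClass H₂) (A : H₁ →L[ℂ] H₁), trace ((Ψ Ω).1 * A) = trace (Ω.1 * Φ A)

end TraceClass

section POVM

variable {α : Type*} [MeasurableSpace α]
variable {H : Type*} [NormedAddCommGroup H] [InnerProductSpace ℂ H] [CompleteSpace H]

/-- A positive operator-valued measure on `α`: a map `X ↦ E(X)` on the measurable sets such that
for every state `ρ` the assignment `X ↦ tr[ρ E(X)]` is a probability measure. (The values on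
non-measurable sets are irrelevant.) -/
structure POVM (α : Type*) [MeasurableSpace α]
    (H : Type*) [NormedAddCommGroup H] [InnerProductSpace ℂ H] [CompleteSpace H] where
  toFun : Set α → (H →L[ℂ] H)
  exists_measure : ∀ ρ : DensityOperator H, ∃ μ : ProbabilityMeasure α,
    ∀ X, MeasurableSet X → trace (ρ.op * toFun X) = (((μ : Measure α).real X : ℝ) : ℂ)

namespace POVM

instance : CoeFun (POVM α H) (fun _ => Set α → (H →L[ℂ] H)) := ⟨toFun⟩

/-- The Born probability measure `X ↦ tr[ρ E(X)]`. -/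
def bornMeasure (E : POVM α H) (ρ : DensityOperator H) : ProbabilityMeasure α :=
  (E.exists_measure ρ).choose

lemma bornMeasure_spec (E : POVM α H) (ρ : DensityOperator H) {X : Set α} (hX : MeasurableSet X) :
    trace (ρ.op * E X) = (((E.bornMeasure ρ : Measure α).real X : ℝ) : ℂ) :=
  (E.exists_measure ρ).choose_spec X hX

/-- Localizability (the `ε`-decidability property): for every nonzero effect `E(X)` and `ε > 0`
there is a pure state giving `X` a probability larger than `1 - ε`. -/
def IsLocalizable (E : POVM α H) : Prop :=
  ∀ X, MeasurableSet X → E X ≠ 0 → ∀ ε : ℝ, 0 < ε →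
    ∃ ξ : H, ‖ξ‖ = 1 ∧ 1 - ε < (⟪ξ, E X ξ⟫_ℂ).re

/-- A localizing sequence centred at `x`: a sequence of pure states whose Born measures converge
weakly to the Dirac measure at `x`. -/
def IsLocalizingSequence [TopologicalSpace α] [OpensMeasurableSpace α] (E : POVM α H) (x : α)
    (ω : ℕ → DensityOperator H) : Prop :=
  (∀ n, (ω n).IsPure) ∧ Tendsto (fun n => E.bornMeasure (ω n)) atTop (𝓝 (diracProba x))

lemma inner_pure (E : POVM α H) {ξ : H} (hξ : ‖ξ‖ = 1) {X : Set α} (hX : MeasurableSet X) :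
    ⟪ξ, E X ξ⟫_ℂ = (((E.bornMeasure (pureState ξ hξ) : Measure α).real X : ℝ) : ℂ) := by
  rw [← E.bornMeasure_spec _ hX, ← trace_ketbra_mul]; rfl

/-- Two bounded operators with equal expectation values in all unit vectors are equal. -/
lemma ext_unit {S T : H →L[ℂ] H} (h : ∀ ξ : H, ‖ξ‖ = 1 → ⟪ξ, S ξ⟫_ℂ = ⟪ξ, T ξ⟫_ℂ) : S = T := by
  have key : ∀ x : H, ⟪x, S x⟫_ℂ = ⟪x, T x⟫_ℂ := by
    intro x
    rcases eq_or_ne x 0 with rfl | hx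
    · simp
    · have hn : ‖((‖x‖⁻¹ : ℝ) : ℂ) • x‖ = 1 := by
        rw [norm_smul]; simp [norm_ne_zero_iff.mpr hx]
      have h1 := h _ hn
      simp only [map_smul, inner_smul_left, inner_smul_right] at h1
      have hc : ((‖x‖⁻¹ : ℝ) : ℂ) ≠ 0 := by simp [hx]
      have hc' : (starRingEnd ℂ) ((‖x‖⁻¹ : ℝ) : ℂ) ≠ 0 := by simpa using hx
      exact mul_left_cancel₀ hc' (mul_left_cancel₀ hc h1)
  have : (S : H →ₗ[ℂ] H) = T := by
    rw [← ext_inner_map]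
    intro x
    have := congrArg (starRingEnd ℂ) (key x)
    simpa using this
  exact ContinuousLinearMap.coe_injective this

lemma exists_vector_measure (E : POVM α H) (x : H) : ∃ μ : Measure α, IsFiniteMeasure μ ∧
    μ.real Set.univ = ‖x‖ ^ 2 ∧
    ∀ X, MeasurableSet X → ⟪x, E X x⟫_ℂ = ((μ.real X : ℝ) : ℂ) := by
  rcases eq_or_ne x 0 with rfl | hx
  · exact ⟨0, inferInstance, by simp, by simp⟩
  · have hx' : (‖x‖ : ℝ) ≠ 0 := norm_ne_zero_iff.mpr hx
    have hn : ‖((‖x‖⁻¹ : ℝ) : ℂ) • x‖ = 1 := by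
      rw [norm_smul]; simp [hx']
    have hp : 0 ≤ ‖x‖ ^ 2 := by positivity
    refine ⟨Real.toNNReal (‖x‖ ^ 2) • (E.bornMeasure (pureState _ hn) : Measure α),
      inferInstance, ?_, ?_⟩
    · rw [measureReal_nnreal_smul_apply]
      simp [hp]
    · intro X hX
      have h1 := E.inner_pure hn hX
      rw [measureReal_nnreal_smul_apply, Real.coe_toNNReal _ hp, Complex.ofReal_mul, ← h1]
      have hc : (‖x‖ : ℂ) ≠ 0 := by exact_mod_cast hx'
      simp only [map_smul, inner_smul_left, inner_smul_right, Complex.conj_ofReal]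
      push_cast
      field_simp

lemma nonneg (E : POVM α H) {X : Set α} (hX : MeasurableSet X) : 0 ≤ E X := by
  rw [ContinuousLinearMap.nonneg_iff_isPositive, ContinuousLinearMap.isPositive_iff_complex]
  intro x
  obtain ⟨μ, -, -, h⟩ := E.exists_vector_measure x
  have h1 : ⟪E X x, x⟫_ℂ = ((μ.real X : ℝ) : ℂ) := by
    rw [← inner_conj_symm, h X hX, Complex.conj_ofReal]
  rw [h1]
  simp

lemma sum_fibers (E : POVM α H) {β : Type*} (q : SimpleFunc α β) :
    ∑ k ∈ q.range, E (q ⁻¹' {k}) = 1 := by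
  refine ext_unit fun ξ hξ => ?_
  obtain ⟨μ, _, h1, h⟩ := E.exists_vector_measure ξ
  rw [sum_apply, inner_sum]
  simp_rw [h _ (q.measurableSet_preimage _)]
  have h2 : ∑ k ∈ q.range, μ.real (q ⁻¹' {k}) = μ.real Set.univ := by
    simp only [Measure.real]
    rw [← ENNReal.toReal_sum (fun _ _ => measure_ne_top _ _),
      q.sum_range_measure_preimage_singleton]
  rw [← Complex.ofReal_sum, h2, h1, hξ]
  simp [inner_self_eq_norm_sq_to_K, hξ]

end POVM
end POVM

section Composite

variable (HR HS : Type*) [NormedAddCommGroup HR] [InnerProductSpace ℂ HR]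
  [NormedAddCommGroup HS] [InnerProductSpace ℂ HS]

/-- The Hilbert space tensor product: the completion of the algebraic tensor product. -/
abbrev Composite : Type _ := UniformSpace.Completion (HR ⊗[ℂ] HS)

variable {HR HS}

/-- The product vector `ξ ⊗ η` in the Hilbert space tensor product. -/
def prodVec (ξ : HR) (η : HS) : Composite HR HS := ((ξ ⊗ₜ[ℂ] η : HR ⊗[ℂ] HS) : Composite HR HS)

/-- The operator `A ⊗ B` on the Hilbert space tensor product. -/
def tensorOp (A : HR →L[ℂ] HR) (B : HS →L[ℂ] HS) : Composite HR HS →L[ℂ] Composite HR HS :=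
  (TensorProduct.mapL A B).completion

/-- The bounded operator `η ↦ ξ ⊗ η`. -/
def attach (ξ : HR) : HS →L[ℂ] Composite HR HS :=
  UniformSpace.Completion.toComplL ∘L TensorProduct.mkL ℂ HR HS ξ

lemma attach_apply (ξ : HR) (η : HS) : attach ξ η = prodVec ξ η := rfl

lemma tensorOp_prodVec (A : HR →L[ℂ] HR) (B : HS →L[ℂ] HS) (ξ : HR) (η : HS) :
    tensorOp A B (prodVec ξ η) = prodVec (A ξ) (B η) := by
  simp [tensorOp, prodVec]

lemma inner_prodVec (ξ ξ' : HR) (η η' : HS) :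
    ⟪prodVec ξ η, prodVec ξ' η'⟫_ℂ = ⟪ξ, ξ'⟫_ℂ * ⟪η, η'⟫_ℂ := by
  simp [prodVec]


lemma inner_rTensor (R : HR →L[ℂ] HR) (hR : ∀ a b, ⟪R a, b⟫_ℂ = ⟪a, R b⟫_ℂ) (x y : HR ⊗[ℂ] HS) :
    ⟪R.rTensor HS x, y⟫_ℂ = ⟪x, R.rTensor HS y⟫_ℂ := by
  induction x with
  | zero => simp
  | add x₁ x₂ h₁ h₂ => rw [map_add, inner_add_left, inner_add_left, h₁, h₂]
  | tmul a b =>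
    induction y with
    | zero => simp
    | add y₁ y₂ h₁ h₂ => rw [map_add, inner_add_right, inner_add_right, h₁, h₂]
    | tmul c d => simp [hR]

end Composite

section OperatorIntegral

variable {α : Type*} [MeasurableSpace α]
variable {HR HS : Type*} [NormedAddCommGroup HR] [InnerProductSpace ℂ HR] [CompleteSpace HR]
  [NormedAddCommGroup HS] [InnerProductSpace ℂ HS] [CompleteSpace HS]

/-- `∑ E(X_k) ⊗ f(a_k)` for a finite measurable partition has norm at most `sup ‖f‖`. -/
lemma norm_simple_sum_le (E : POVM α HR) (f : α → (HS →L[ℂ] HS)) {C : ℝ} (hC : 0 ≤ C)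
    (hf : ∀ a, ‖f a‖ ≤ C) (q : SimpleFunc α α) :
    ‖∑ k ∈ q.range, TensorProduct.mapL (E (q ⁻¹' {k})) (f k)‖ ≤ C := by
  classical
  set R : α → (HR →L[ℂ] HR) := fun k => CFC.sqrt (E (q ⁻¹' {k})) with hRdef
  have hsymm : ∀ k a b, ⟪R k a, b⟫_ℂ = ⟪a, R k b⟫_ℂ := by
    intro k a b
    have := (ContinuousLinearMap.nonneg_iff_isPositive _).1 (CFC.sqrt_nonneg (E (q ⁻¹' {k})))
    exact this.inner_left_eq_inner_right a b
  have hRR : ∀ k, R k * R k = E (q ⁻¹' {k}) := fun k =>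
    CFC.sqrt_mul_sqrt_self _ (E.nonneg (q.measurableSet_preimage _))
  have hfac : ∀ k (x y : HR ⊗[ℂ] HS), ⟪x, TensorProduct.mapL (E (q ⁻¹' {k})) (f k) y⟫_ℂ =
      ⟪(R k).rTensor HS x, (f k).lTensor HR ((R k).rTensor HS y)⟫_ℂ := by
    intro k x y
    rw [inner_rTensor _ (hsymm k), ← hRR k]
    congr 1
    induction y with
    | zero => simp
    | add y₁ y₂ h₁ h₂ => simp only [map_add, h₁, h₂]
    | tmul c d => simp
  have hself : ∀ z : HR ⊗[ℂ] HS, ⟪z, z⟫_ℂ = ((‖z‖ ^ 2 : ℝ) : ℂ) := by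
    intro z
    have := inner_self_eq_norm_sq_to_K (𝕜 := ℂ) z
    rw [this]; push_cast; rfl
  have hsq : ∀ x : HR ⊗[ℂ] HS, ∑ k ∈ q.range, ‖(R k).rTensor HS x‖ ^ 2 = ‖x‖ ^ 2 := by
    intro x
    have h1 : ∀ k, ((‖(R k).rTensor HS x‖ ^ 2 : ℝ) : ℂ) =
        ⟪x, (E (q ⁻¹' {k})).rTensor HS x⟫_ℂ := by
      intro k
      have e : (E (q ⁻¹' {k})).rTensor HS x = (R k).rTensor HS ((R k).rTensor HS x) := by
        rw [← hRR k, ContinuousLinearMap.rTensor_mul]; rfl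
      rw [e, ← inner_rTensor _ (hsymm k), hself]
    have h2 : ∀ s : Finset α, ∑ k ∈ s, (E (q ⁻¹' {k})).rTensor HS x =
        (∑ k ∈ s, E (q ⁻¹' {k})).rTensor HS x := by
      intro s
      induction s using Finset.induction_on with
      | empty => simp
      | insert a s ha ih =>
        rw [Finset.sum_insert ha, Finset.sum_insert ha, ih, ContinuousLinearMap.rTensor_add]
        rfl
    have h3 : ((∑ k ∈ q.range, ‖(R k).rTensor HS x‖ ^ 2 : ℝ) : ℂ) = ((‖x‖ ^ 2 : ℝ) : ℂ) := by
      rw [Complex.ofReal_sum]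
      simp_rw [h1]
      have e : ∑ k ∈ q.range, ⟪x, (E (q ⁻¹' {k})).rTensor HS x⟫_ℂ =
          ⟪x, ∑ k ∈ q.range, (E (q ⁻¹' {k})).rTensor HS x⟫_ℂ 
          := by rw [inner_sum]
      rw [e, h2, E.sum_fibers, ContinuousLinearMap.rTensor_one, ← hself]
      rfl
    exact_mod_cast h3
  refine ContinuousLinearMap.opNorm_le_bound _ hC fun y => ?_
  set S := ∑ k ∈ q.range, TensorProduct.mapL (E (q ⁻¹' {k})) (f k) with hS
  have hb : ∀ x y : HR ⊗[ℂ] HS, ‖⟪x, S y⟫_ℂ‖ ≤ C * (‖x‖ * ‖y‖) := by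
    intro x y
    have e1 : ⟪x, S y⟫_ℂ = ∑ k ∈ q.range,
        ⟪(R k).rTensor HS x, (f k).lTensor HR ((R k).rTensor HS y)⟫_ℂ := by
      rw [hS, sum_apply, inner_sum]
      exact Finset.sum_congr rfl fun k _ => hfac k x y
    rw [e1]
    calc _ ≤ ∑ k ∈ q.range, C * (‖(R k).rTensor HS x‖ * ‖(R k).rTensor HS y‖) := by
          refine (norm_sum_le _ _).trans (Finset.sum_le_sum fun k _ => ?_)
          refine (norm_inner_le_norm _ _).trans ?_
          have h4 : ‖(f k).lTensor HR ((R k).rTensor HS y)‖ ≤ C * ‖(R k).rTensor HS y‖ :=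
            ((f k).lTensor HR).le_of_opNorm_le
              ((ContinuousLinearMap.norm_lTensor_le _ (f k)).trans (hf k)) _
          calc _ ≤ ‖(R k).rTensor HS x‖ * (C * ‖(R k).rTensor HS y‖) := by gcongr
            _ = _ := by ring
      _ = C * ∑ k ∈ q.range, ‖(R k).rTensor HS x‖ * ‖(R k).rTensor HS y‖ := by
          rw [Finset.mul_sum]
      _ ≤ C * (‖x‖ * ‖y‖) := by
          gcongr
          refine (Real.sum_mul_le_sqrt_mul_sqrt _ _ _).trans ?_
          rw [hsq, hsq, Real.sqrt_sq (norm_nonneg _), Real.sqrt_sq (norm_nonneg _)]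
  have h5 := hb (S y) y
  rw [hself, Complex.norm_real, Real.norm_of_nonneg (by positivity)] at h5
  rcases eq_or_lt_of_le (norm_nonneg (S y)) with h6 | h6
  · rw [← h6]; positivity
  · nlinarith

/-- A bounded family of operators has a weak cluster point along any filter. -/
lemma exists_weak_limit {ι K : Type*} [NormedAddCommGroup K] [InnerProductSpace ℂ K]
    [CompleteSpace K] (l : Filter ι) [l.NeBot] (S : ι → (K →L[ℂ] K)) (C : ℝ)
    (hS : ∀ i, ‖S i‖ ≤ C) : ∃ T : K →L[ℂ] K, ∀ x y (c : ℂ),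
      Tendsto (fun i => ⟪x, S i y⟫_ℂ) l (𝓝 c) → ⟪x, T y⟫_ℂ = c := by
  set u : Ultrafilter ι := Ultrafilter.of l
  have hul : (u : Filter ι) ≤ l := Ultrafilter.of_le l
  have hbound : ∀ x y i, ‖⟪x, S i y⟫_ℂ‖ ≤ C * ‖x‖ * ‖y‖ := by
    intro x y i
    refine (norm_inner_le_norm _ _).trans ?_
    calc _ ≤ ‖x‖ * (C * ‖y‖) := by gcongr; exact (S i).le_of_opNorm_le (hS i) y
      _ = _ := by ring
  have hlim : ∀ x y, ∃ c : ℂ, ‖c‖ ≤ C * ‖x‖ * ‖y‖ ∧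
      Tendsto (fun i => ⟪x, S i y⟫_ℂ) u (𝓝 c) := by
    intro x y
    have hc := (isCompact_closedBall (0 : ℂ) (C * ‖x‖ * ‖y‖)).ultrafilter_le_nhds
      (u.map fun i => ⟪x, S i y⟫_ℂ) (by
        rw [Filter.le_principal_iff]
        exact Filter.mem_map.2 (Filter.Eventually.of_forall fun i => by
          simpa [mem_closedBall_zero_iff] using hbound x y i))
    obtain ⟨c, hc1, hc2⟩ := hc
    exact ⟨c, by simpa using hc1, hc2⟩
  choose B hB1 hB2 using hlim
  have huniq : ∀ x y c, Tendsto (fun i => ⟪x, S i y⟫_ℂ) u (𝓝 c) → B x y = c :=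
    fun x y c h => tendsto_nhds_unique (hB2 x y) h
  let L : K →ₗ⋆[ℂ] K →ₗ[ℂ] ℂ := LinearMap.mk₂'ₛₗ (starRingEnd ℂ) (RingHom.id ℂ) B
    (fun x x' y => huniq _ _ _ (by simpa [inner_add_left] using (hB2 x y).add (hB2 x' y)))
    (fun c x y => huniq _ _ _ (by
      simpa only [ContinuousLinearMap.map_smul, inner_smul_left, smul_eq_mul] using
        (hB2 x y).const_mul (starRingEnd ℂ c)))
    (fun x y y' => huniq _ _ _ (by simpa [inner_add_right] using (hB2 x y).add (hB2 x y')))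
    (fun c x y => huniq _ _ _ (by simpa [inner_smul_right] using (hB2 x y).const_mul c))
  let Lc : K →L⋆[ℂ] K →L[ℂ] ℂ := L.mkContinuous₂ C fun x y => hB1 x y
  refine ⟨(InnerProductSpace.continuousLinearMapOfBilin Lc).adjoint, fun x y c h => ?_⟩
  rw [ContinuousLinearMap.adjoint_inner_right, InnerProductSpace.continuousLinearMapOfBilin_apply]
  exact huniq x y c (h.mono_left hul)

/-- A bounded, weakly measurable family of operators is approximated by simple ones, uniformly in
finitely many matrix elements. -/
lemma exists_simple_approx [Nonempty α] (f : α → (HS →L[ℂ] HS)) {C : ℝ} (hf : ∀ a, ‖f a‖ ≤ C)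
    (hm : ∀ η η' : HS, Measurable fun a => ⟪η, f a η'⟫_ℂ) (F : Finset (HS × HS)) {ε : ℝ}
    (hε : 0 < ε) : ∃ q : SimpleFunc α α, ∀ p ∈ F, ∀ a,
      ‖⟪p.1, f (q a) p.2⟫_ℂ - ⟪p.1, f a p.2⟫_ℂ‖ ≤ ε := by
  classical
  let Φ : α → (F → ℂ) := fun a p => ⟪p.1.1, f a p.1.2⟫_ℂ
  have hΦ : Measurable Φ := measurable_pi_lambda _ fun p => hm _ _
  have hbdd : TotallyBounded (Set.range Φ) := by
    suffices h : Bornology.IsBounded (Set.range Φ) from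
      h.isCompact_closure.totallyBounded.subset subset_closure
    refine Bornology.forall_isBounded_image_eval_iff.1 fun p => ?_
    refine (Metric.isBounded_closedBall (x := (0 : ℂ)) (r := ‖p.1.1‖ * (C * ‖p.1.2‖))).subset ?_
    rintro _ ⟨_, ⟨a, rfl⟩, rfl⟩
    rw [mem_closedBall_zero_iff]
    refine (norm_inner_le_norm _ _).trans ?_
    gcongr
    exact (f a).le_of_opNorm_le (hf a) _
  obtain ⟨t, ht1, ht2, ht3⟩ := Metric.finite_approx_of_totallyBounded hbdd ε hε
  obtain ⟨u, rfl⟩ : ∃ u : Finset α, Φ '' (u : Set α) = t := by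
    obtain ⟨u, -, hu, hu'⟩ := Set.Finite.exists_subset_finite_image_eq
      (f := Φ) (s := Set.univ) (u := t) ht2 (by simpa using ht1)
    exact ⟨hu.toFinset, by simpa using hu'⟩
  let e : ℕ → α := fun k => if h : k < u.card then (u.equivFin.symm ⟨k, h⟩).1
    else Classical.arbitrary α
  refine ⟨((SimpleFunc.nearestPtInd (Φ ∘ e) u.card).comp Φ hΦ).map e, fun p hp a => ?_⟩
  set q := ((SimpleFunc.nearestPtInd (Φ ∘ e) u.card).comp Φ hΦ).map e with hq
  have h1 : Φ (q a) = SimpleFunc.nearestPt (Φ ∘ e) u.card (Φ a) := rfl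
  have h2 : ∃ k ≤ u.card, dist (Φ (e k)) (Φ a) ≤ ε := by
    obtain ⟨_, ⟨x, hx, rfl⟩, hx2⟩ := Set.mem_iUnion₂.1 (ht3 ⟨a, rfl⟩)
    refine ⟨u.equivFin ⟨x, hx⟩, (u.equivFin ⟨x, hx⟩).2.le, ?_⟩
    have : e (u.equivFin ⟨x, hx⟩) = x := by simp [e]
    rw [this, dist_comm]
    exact (Metric.mem_ball.1 hx2).le
  obtain ⟨k, hk, hd⟩ := h2
  have h3 := SimpleFunc.edist_nearestPt_le (Φ ∘ e) (Φ a) hk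
  rw [← h1, edist_dist, edist_dist, ENNReal.ofReal_le_ofReal_iff dist_nonneg] at h3
  have h4 := (dist_le_pi_dist (Φ (q a)) (Φ a) ⟨p, hp⟩).trans (h3.trans hd)
  rwa [dist_eq_norm] at h4

lemma integral_comp_simple (q : SimpleFunc α α) (h : α → ℂ) (μ : Measure α) [IsFiniteMeasure μ] :
    ∫ a, h (q a) ∂μ = ∑ k ∈ q.range, (μ.real (q ⁻¹' {k}) : ℂ) * h k := by
  classical
  have h1 : ∀ a, h (q a) = ∑ k ∈ q.range, (q ⁻¹' {k}).indicator (fun _ => h k) a := by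
    intro a
    rw [Finset.sum_eq_single (q a)]
    · simp
    · intro b _ hb
      simp [Set.indicator, hb.symm]
    · intro hn; exact absurd (q.mem_range_self a) hn
  simp_rw [h1]
  rw [integral_finsetSum]
  · refine Finset.sum_congr rfl fun k _ => ?_
    rw [integral_indicator_const _ (q.measurableSet_preimage _)]
    simp
  · intro k _
    exact (integrable_const _).indicator (q.measurableSet_preimage _)

/-- Existence of the operator-valued integral `∫ dE(a) ⊗ f(a)` in the weak sense. -/
lemma exists_operatorIntegral [Nonempty α] (E : POVM α HR) (f : α → (HS →L[ℂ] HS)) {C : ℝ}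
    (hC : 0 ≤ C) (hf : ∀ a, ‖f a‖ ≤ C) (hm : ∀ η η' : HS, Measurable fun a => ⟪η, f a η'⟫_ℂ) :
    ∃ T : Composite HR HS →L[ℂ] Composite HR HS, ∀ (ξ : HR) (hξ : ‖ξ‖ = 1) (η η' : HS),
      ⟪prodVec ξ η, T (prodVec ξ η')⟫_ℂ =
        ∫ a, ⟪η, f a η'⟫_ℂ ∂(E.bornMeasure (pureState ξ hξ) : Measure α) := by
  classical
  choose q hq using fun i : Finset (HS × HS) × ℕ =>
    exists_simple_approx f hf hm i.1 (ε := 1 / ((i.2 : ℝ) + 1)) (by positivity)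
  let S : Finset (HS × HS) × ℕ → (Composite HR HS →L[ℂ] Composite HR HS) := fun i =>
    (∑ k ∈ (q i).range, TensorProduct.mapL (E (q i ⁻¹' {k})) (f k)).completion
  have hS : ∀ i, ‖S i‖ ≤ C := by
    intro i
    refine ContinuousLinearMap.opNorm_le_bound _ hC fun x => ?_
    induction x using UniformSpace.Completion.induction_on with
    | hp => exact isClosed_le (by fun_prop) (by fun_prop)
    | ih x =>
      rw [ContinuousLinearMap.completion_apply_coe, UniformSpace.Completion.norm_coe,
        UniformSpace.Completion.norm_coe]
      exact ContinuousLinearMap.le_of_opNorm_le _ (norm_simple_sum_le E f hC hf (q i)) x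
  obtain ⟨T, hT⟩ := exists_weak_limit atTop S C hS
  refine ⟨T, fun ξ hξ η η' => hT _ _ _ ?_⟩
  set μ : Measure α := (E.bornMeasure (pureState ξ hξ) : Measure α) with hμ
  have hval : ∀ i, ⟪prodVec ξ η, S i (prodVec ξ η')⟫_ℂ = ∫ a, ⟪η, f (q i a) η'⟫_ℂ ∂μ := by
    intro i
    rw [integral_comp_simple (q i) (fun a => ⟪η, f a η'⟫_ℂ) μ]
    simp only [S, prodVec, ContinuousLinearMap.completion_apply_coe,
      UniformSpace.Completion.inner_coe, sum_apply, inner_sum, TensorProduct.mapL_tmul,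
      TensorProduct.inner_tmul]
    refine Finset.sum_congr rfl fun k _ => ?_
    rw [E.inner_pure hξ ((q i).measurableSet_preimage _)]
  have hint : Integrable (fun a => ⟪η, f a η'⟫_ℂ) μ := by
    refine Integrable.of_bound (hm η η').aestronglyMeasurable (‖η‖ * (C * ‖η'‖))
      (Eventually.of_forall fun a => (norm_inner_le_norm _ _).trans ?_)
    gcongr
    exact (f a).le_of_opNorm_le (hf a) _
  have hint' : ∀ i, Integrable (fun a => ⟪η, f (q i a) η'⟫_ℂ) μ := by
    intro i
    refine Integrable.of_bound (Measurable.fun_comp (hm η η') ?_).aestronglyMeasurable (‖η‖ * (C * ‖η'‖))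
      (Eventually.of_forall fun a => (norm_inner_le_norm _ _).trans ?_)
    · exact (q i).measurable
    · gcongr
      exact (f _).le_of_opNorm_le (hf _) _
  rw [tendsto_iff_norm_sub_tendsto_zero]
  have hlim : Tendsto (fun i : Finset (HS × HS) × ℕ => 1 / ((i.2 : ℝ) + 1)) atTop (𝓝 0) := by
    rw [← prod_atTop_atTop_eq]
    exact tendsto_one_div_add_atTop_nhds_zero_nat.comp tendsto_snd
  refine squeeze_zero' (Eventually.of_forall fun i => norm_nonneg _) ?_ hlim
  filter_upwards [eventually_ge_atTop (({(η, η')}, 0) : Finset (HS × HS) × ℕ)] with i hi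
  rw [hval, ← integral_sub (hint' i) hint]
  refine (norm_integral_le_of_norm_le_const (C := 1 / ((i.2 : ℝ) + 1))
    (Eventually.of_forall fun a => ?_)).trans ?_
  · exact hq i (η, η') (hi.1 (Finset.mem_singleton_self _)) a
  · simp

end OperatorIntegral

section Frames

variable (G : Type*) [Group G] [TopologicalSpace G]
variable (H : Type*) [NormedAddCommGroup H] [InnerProductSpace ℂ H] [CompleteSpace H]

/-- A (possibly projective) unitary representation of `G`: `U(gh)` and `U(g) U(h)` differ by a
phase, and `g ↦ |⟨ξ, U(g) η⟩|` is continuous, which is the strong continuity of the induced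
homomorphism into the projective unitary group. Strongly continuous unitary representations are
the case in which all phases are `1`. -/
structure ProjectiveRep where
  toFun : G → unitary (H →L[ℂ] H)
  map_mul : ∀ g h, ∃ c : ℂ, ‖c‖ = 1 ∧
    (toFun (g * h) : H →L[ℂ] H) = c • ((toFun g : H →L[ℂ] H) * (toFun h : H →L[ℂ] H))
  continuous_norm_inner : ∀ ξ η : H, Continuous fun g => ‖⟪ξ, (toFun g : H →L[ℂ] H) η⟫_ℂ‖

variable {G H}

namespace ProjectiveRep

/-- The action `g.A = U(g) A U(g)*` on bounded operators. -/
def conj (U : ProjectiveRep G H) (g : G) (A : H →L[ℂ] H) : H →L[ℂ] H :=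
  (U.toFun g : H →L[ℂ] H) * A * star (U.toFun g : H →L[ℂ] H)

lemma norm_conj_le (U : ProjectiveRep G H) (g : G) (A : H →L[ℂ] H) : ‖U.conj g A‖ ≤ ‖A‖ := by
  unfold conj
  rw [← Unitary.coe_star, CStarRing.norm_mul_coe_unitary, CStarRing.norm_coe_unitary_mul]

lemma continuous_inner_conj_self (U : ProjectiveRep G H) (A : H →L[ℂ] H) (ξ : H) :
    Continuous fun g => ⟪U.conj g A ξ, ξ⟫_ℂ := by
  set w : G → H := fun g => (star (U.toFun g : H →L[ℂ] H)) ξ with hw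
  have hadj : ∀ g (x y : H), ⟪(U.toFun g : H →L[ℂ] H) x, y⟫_ℂ =
      ⟪x, (star (U.toFun g : H →L[ℂ] H)) y⟫_ℂ := by
    intro g x y
    rw [ContinuousLinearMap.star_eq_adjoint, ContinuousLinearMap.adjoint_inner_right]
  have hnorm : ∀ g, ‖w g‖ = ‖ξ‖ := by
    intro g
    have h1 : (U.toFun g : H →L[ℂ] H) (w g) = ξ := by
      have : (U.toFun g : H →L[ℂ] H) * star (U.toFun g : H →L[ℂ] H) = 1 :=
        Unitary.mul_star_self_of_mem (U.toFun g).2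
      calc _ = ((U.toFun g : H →L[ℂ] H) * star (U.toFun g : H →L[ℂ] H)) ξ := rfl
        _ = ξ := by rw [this]; rfl
    have h2 : ⟪w g, w g⟫_ℂ = ⟪ξ, ξ⟫_ℂ := by
      conv_lhs => rw [hw]
      simp only
      rw [← hadj]
      exact congrArg (fun z => ⟪z, ξ⟫_ℂ) h1
    rw [inner_self_eq_norm_sq_to_K, inner_self_eq_norm_sq_to_K] at h2
    have h3 : ‖w g‖ ^ 2 = ‖ξ‖ ^ 2 := by exact_mod_cast h2
    exact (sq_eq_sq₀ (norm_nonneg _) (norm_nonneg _)).1 h3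
  have hval : ∀ g, ⟪U.conj g A ξ, ξ⟫_ℂ = ⟪A (w g), w g⟫_ℂ := by
    intro g; exact hadj g _ _
  simp_rw [hval]
  rw [continuous_iff_continuousAt]
  intro g₀
  have ht : Tendsto (fun g => ‖⟪w g₀, w g⟫_ℂ‖) (𝓝 g₀) (𝓝 (‖ξ‖ ^ 2)) := by
    have h1 := (U.continuous_norm_inner ξ (w g₀)).tendsto g₀
    have h2 : ∀ g, ‖⟪ξ, (U.toFun g : H →L[ℂ] H) (w g₀)⟫_ℂ‖ = ‖⟪w g₀, w g⟫_ℂ‖ := by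
      intro g; rw [norm_inner_symm, hadj]
    simp_rw [h2] at h1
    convert h1 using 2
    rw [inner_self_eq_norm_sq_to_K]
    simp [hnorm]
  have hbound : ∀ g, ‖⟪A (w g), w g⟫_ℂ - ⟪A (w g₀), w g₀⟫_ℂ‖ ≤
      2 * ‖A‖ * ‖ξ‖ * √(2 * ‖ξ‖ ^ 2 - 2 * ‖⟪w g₀, w g⟫_ℂ‖) := by
    intro g
    obtain ⟨c, hc, hcv⟩ : ∃ c : ℂ, ‖c‖ = 1 ∧ c * ⟪w g₀, w g⟫_ℂ = (‖⟪w g₀, w g⟫_ℂ‖ : ℂ) := by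
      rcases eq_or_ne (⟪w g₀, w g⟫_ℂ) 0 with h0 | h0
      · exact ⟨1, by simp, by simp [h0]⟩
      · have h0' : ‖⟪w g₀, w g⟫_ℂ‖ ≠ 0 := norm_ne_zero_iff.2 h0
        refine ⟨(starRingEnd ℂ) ⟪w g₀, w g⟫_ℂ / ‖⟪w g₀, w g⟫_ℂ‖, ?_, ?_⟩
        · rw [norm_div, RCLike.norm_conj, Complex.norm_real, norm_norm, div_self h0']
        · rw [div_mul_eq_mul_div, Complex.conj_mul', sq, mul_div_assoc, div_self, mul_one]
          exact_mod_cast h0'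
    have hd : ‖c • w g - w g₀‖ = √(2 * ‖ξ‖ ^ 2 - 2 * ‖⟪w g₀, w g⟫_ℂ‖) := by
      have h1 := norm_sub_sq (𝕜 := ℂ) (w g₀) (c • w g)
      rw [inner_smul_right, hcv, norm_smul, hc, one_mul, hnorm, hnorm, norm_sub_rev] at h1
      rw [← Real.sqrt_sq (norm_nonneg (c • w g - w g₀)), h1]
      congr 1
      simp only [RCLike.re_to_complex, Complex.ofReal_re]
      ring
    have hcc : (starRingEnd ℂ) c * c = 1 := by
      rw [Complex.conj_mul', hc]; simp
    have he : ⟪A (w g), w g⟫_ℂ = ⟪A (c • w g), c • w g⟫_ℂ := by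
      rw [map_smul, inner_smul_left, inner_smul_right, ← mul_assoc, hcc, one_mul]
    rw [he, ← hd]
    have hs : ⟪A (c • w g), c • w g⟫_ℂ - ⟪A (w g₀), w g₀⟫_ℂ =
        ⟪A (c • w g - w g₀), c • w g⟫_ℂ + ⟪A (w g₀), c • w g - w g₀⟫_ℂ := by
      rw [map_sub, inner_sub_left, inner_sub_right]; ring
    rw [hs]
    have hcw : ‖c • w g‖ = ‖ξ‖ := by rw [norm_smul, hc, one_mul, hnorm]
    calc _ ≤ ‖A‖ * ‖c • w g - w g₀‖ * ‖c • w g‖ + ‖A‖ * ‖w g₀‖ * ‖c • w g - w g₀‖ := by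
          refine (norm_add_le _ _).trans (add_le_add ?_ ?_) <;>
            refine (norm_inner_le_norm _ _).trans ?_ <;> gcongr <;> exact A.le_opNorm _
      _ = _ := by rw [hcw, hnorm]; ring
  rw [ContinuousAt, tendsto_iff_norm_sub_tendsto_zero]
  refine squeeze_zero (fun g => norm_nonneg _) hbound ?_
  have h5 : Tendsto (fun g => 2 * ‖A‖ * ‖ξ‖ * √(2 * ‖ξ‖ ^ 2 - 2 * ‖⟪w g₀, w g⟫_ℂ‖)) (𝓝 g₀)
      (𝓝 (2 * ‖A‖ * ‖ξ‖ * √(2 * ‖ξ‖ ^ 2 - 2 * ‖ξ‖ ^ 2))) :=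
    ((Real.continuous_sqrt.tendsto _).comp ((ht.const_mul 2).const_sub _)).const_mul _
  simpa using h5

lemma continuous_inner_conj (U : ProjectiveRep G H) (A : H →L[ℂ] H) (η η' : H) :
    Continuous fun g => ⟪η, U.conj g A η'⟫_ℂ := by
  have h1 : ∀ g, ⟪η, U.conj g A η'⟫_ℂ = (starRingEnd ℂ) ⟪U.conj g A η', η⟫_ℂ :=
    fun g => (inner_conj_symm _ _).symm
  have h2 := fun g => inner_map_polarization' (U.conj g A : H →ₗ[ℂ] H) η' η
  simp only [ContinuousLinearMap.coe_coe] at h2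
  simp_rw [h1, h2]
  have := U.continuous_inner_conj_self A
  fun_prop

end ProjectiveRep

variable (G H)

/-- A principal quantum reference frame: a POVM on the Borel sets of the group `G`, acting on
itself by left translations, that is covariant under a representation of `G`. -/
structure PrincipalFrame [MeasurableSpace G] where
  rep : ProjectiveRep G H
  povm : POVM G H
  covariant : ∀ (g : G) (X : Set G), MeasurableSet X →
    povm ((fun x => g * x) '' X) = rep.conj g (povm X)

end Frames

section Relativization

variable {G : Type*} [Group G] [TopologicalSpace G] [MeasurableSpace G] [BorelSpace G]
variable {HR HS : Type*} [NormedAddCommGroup HR] [InnerProductSpace ℂ HR] [CompleteSpace HR]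
  [NormedAddCommGroup HS] [InnerProductSpace ℂ HS] [CompleteSpace HS]

lemma exists_relativization (R : PrincipalFrame G HR) (U : ProjectiveRep G HS)
    (A : HS →L[ℂ] HS) :
    ∃ T : Composite HR HS →L[ℂ] Composite HR HS, ∀ (ξ : HR) (hξ : ‖ξ‖ = 1) (η η' : HS),
      ⟪prodVec ξ η, T (prodVec ξ η')⟫_ℂ =
        ∫ g, ⟪η, U.conj g A η'⟫_ℂ ∂(R.povm.bornMeasure (pureState ξ hξ) : Measure G) :=
  exists_operatorIntegral R.povm (fun g => U.conj g A) (norm_nonneg A)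
    (fun g => U.norm_conj_le g A) (fun η η' => (U.continuous_inner_conj A η η').measurable)

/-- The relativization map `A ↦ ∫ dE(g) ⊗ U(g) A U(g)*`: the bounded operator on the tensor
product with `⟨ξ ⊗ η, ¥(A) (ξ ⊗ η')⟩ = ∫ ⟨η, U(g) A U(g)* η'⟩ dμ_ξ(g)`, where
`μ_ξ(X) = ⟨ξ, E(X) ξ⟩`, for all unit vectors `ξ` and all `η`, `η'`. -/
def relativization (R : PrincipalFrame G HR) (U : ProjectiveRep G HS) (A : HS →L[ℂ] HS) :
    Composite HR HS →L[ℂ] Composite HR HS :=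
  (exists_relativization R U A).choose

lemma relativization_spec (R : PrincipalFrame G HR) (U : ProjectiveRep G HS) (A : HS →L[ℂ] HS)
    (ξ : HR) (hξ : ‖ξ‖ = 1) (η η' : HS) :
    ⟪prodVec ξ η, relativization R U A (prodVec ξ η')⟫_ℂ =
      ∫ g, ⟪η, U.conj g A η'⟫_ℂ ∂(R.povm.bornMeasure (pureState ξ hξ) : Measure G) :=
  (exists_relativization R U A).choose_spec ξ hξ η η'

/-- The restriction map `Γ_ω : A_R ⊗ A_S ↦ tr[ω A_R] A_S` of a state `ω`, that is, the partial
trace of `(√ω ⊗ 1) A (√ω ⊗ 1)` over the first factor, written as the norm-convergent sum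
`∑ᵢ V_{√ω eᵢ}* A V_{√ω eᵢ}` with `V_ξ η = ξ ⊗ η`. -/
def restrictionMap (ω : DensityOperator HR) (A : Composite HR HS →L[ℂ] Composite HR HS) :
    HS →L[ℂ] HS :=
  ∑' i : basisIndex HR,
    (attach (CFC.sqrt ω.op (basis HR i))).adjoint ∘L A ∘L attach (CFC.sqrt ω.op (basis HR i))

/-- The `ω`-conditioned relativization map `Γ_ω ∘ ¥`. -/
def conditionedRelativization (R : PrincipalFrame G HR) (U : ProjectiveRep G HS)
    (ω : DensityOperator HR) (A : HS →L[ℂ] HS) : HS →L[ℂ] HS :=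
  restrictionMap ω (relativization R U A)

end Relativization

end QRF
end

open scoped InnerProductSpace TensorProduct Topology NNReal
open MeasureTheory Filter

noncomputable section

namespace QRF

/-! ### Polar decomposition, Hilbert–Schmidt operators and trace-class duality. -/

section OperatorTheory

variable {H : Type*} [NormedAddCommGroup H] [InnerProductSpace ℂ H]
variable {ι : Type*}

/-! For a pure state, restriction is compression to one slice, so the matrix elements of the
conditioned relativization are the averages `∫ ⟨η, (g.A) η'⟩ dμ_ω(g)`
(`inner_conditionedRelativization`). The integrand is bounded and continuous in `g`, with value `⟨η,
A η'⟩` at the identity, so weak convergence of the Born measures to the Dirac measure gives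
convergence of every matrix element. To reach the ultraweak topology, write `Ω = W P P` with `P =
√|Ω|` Hilbert–Schmidt. Then `tr[Ω A] = ∑ ⟨xᵢ, A yᵢ⟩` with `∑ ‖xᵢ‖ ‖yᵢ‖ < ∞`
(`TraceClass.exists_trace_mul_eq`), and dominated convergence applies because `‖g.A‖ ≤ ‖A‖`.

The predual map exists because `A ↦ tr[Ω ¥_ω(A)]` is a bounded functional that is continuous along
the finite truncations `A P_F`. Such a functional is the trace pairing with the operator whose
matrix elements are its values on rank-one operators (`exists_traceClass_of_functional`). Rank-one
operators also separate trace-class operators, hence uniqueness. Operational convergence of the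
preduals is then ultraweak convergence read through the duality identity. -/

lemma mul_le_sq_add_sq (a b : ℝ) : a * b ≤ a ^ 2 + b ^ 2 := by
  nlinarith [sq_nonneg (a - b), sq_nonneg a, sq_nonneg b]

lemma inner_self_eq_ofReal (x : H) : ⟪x, x⟫_ℂ = ((‖x‖ ^ 2 : ℝ) : ℂ) := by
  rw [inner_self_eq_norm_sq_to_K]; push_cast; rfl

/-- Summability of `‖R eᵢ‖²` over a Hilbert basis is the Hilbert–Schmidt condition on `R`, used in
this form throughout. -/
lemma summable_norm_comp_sq {e : ι → H} {R : H →L[ℂ] H}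
    (hR : Summable fun i => ‖R (e i)‖ ^ 2) (A : H →L[ℂ] H) :
    Summable fun i => ‖(A * R) (e i)‖ ^ 2 := by
  refine Summable.of_nonneg_of_le (fun _ => by positivity) (fun i => ?_) (hR.mul_left (‖A‖ ^ 2))
  rw [← mul_pow]
  gcongr
  exact A.le_opNorm _

lemma hasSum_norm_inner_sq (e : HilbertBasis ι ℂ H) (x : H) : HasSum (fun i => ‖⟪e i, x⟫_ℂ‖ ^ 2) (‖x‖ ^ 2) := by
  have h := e.hasSum_inner_mul_inner x x
  have h1 : ∀ i, ⟪x, e i⟫_ℂ * ⟪e i, x⟫_ℂ = ((‖⟪e i, x⟫_ℂ‖ ^ 2 : ℝ) : ℂ) := fun i => by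
    rw [← inner_conj_symm x (e i), Complex.conj_mul']; push_cast; rfl
  rw [inner_self_eq_ofReal] at h
  simp_rw [h1] at h
  exact Complex.hasSum_ofReal.1 h

lemma summable_prod_norm_inner_sq (e : HilbertBasis ι ℂ H) {R : H →L[ℂ] H}
    (hR : Summable fun i => ‖R (e i)‖ ^ 2) :
    Summable fun p : ι × ι => ‖⟪e p.2, R (e p.1)⟫_ℂ‖ ^ 2 := by
  refine (summable_prod_of_nonneg fun p => sq_nonneg _).2
    ⟨fun i => (hasSum_norm_inner_sq e (R (e i))).summable, ?_⟩
  simp_rw [(hasSum_norm_inner_sq e _).tsum_eq]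
  exact hR

variable [CompleteSpace H]

/-- Douglas factorization for operators with equal norms: `S = W R` for a contraction `W`. -/
lemma exists_contraction_factor {R S : H →L[ℂ] H} (h : ∀ x, ‖S x‖ = ‖R x‖) :
    ∃ W : H →L[ℂ] H, ‖W‖ ≤ 1 ∧ S = W * R := by
  -- Equality of norms makes `R x ↦ S x` well defined and isometric on the range of `R`. It extends
  -- by density to the closure `K`, and `W` is zero on the complement of `K`.
  let K : Submodule ℂ H := (LinearMap.range (R : H →ₗ[ℂ] H)).topologicalClosure
  have hK : ∀ x, R x ∈ K := fun x => Submodule.le_topologicalClosure _ ⟨x, rfl⟩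
  have : CompleteSpace K := (Submodule.isClosed_topologicalClosure _).completeSpace_coe
  let e : H →ₗ[ℂ] K := (R : H →ₗ[ℂ] H).codRestrict K hK
  have he : DenseRange e := by
    intro y
    have hy : (y : H) ∈ closure (Set.range R) := y.2
    rw [closure_subtype]
    convert hy using 1
    congr 1
    ext z
    constructor
    · rintro ⟨_, ⟨x, rfl⟩, rfl⟩; exact ⟨x, rfl⟩
    · rintro ⟨x, rfl⟩; exact ⟨e x, ⟨x, rfl⟩, rfl⟩
  have hn : ∀ x, ‖(S : H →ₗ[ℂ] H) x‖ ≤ 1 * ‖e x‖ := fun x => by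
    rw [one_mul]; exact (h x).le
  refine ⟨((S : H →ₗ[ℂ] H).extendOfNorm e) ∘L K.orthogonalProjectionOnto, ?_, ?_⟩
  · refine ContinuousLinearMap.opNorm_le_bound _ zero_le_one fun x => ?_
    refine (LinearMap.norm_extendOfNorm_apply_le he 1 hn _).trans ?_
    gcongr
    exact K.norm_orthogonalProjectionOnto_apply_le x
  · ext x
    have h1 : K.orthogonalProjectionOnto (R x) = e x :=
      K.orthogonalProjectionOnto_mem_subspace_eq_self (e x)
    have h2 := LinearMap.extendOfNorm_eq he ⟨1, hn⟩ x
    simp [h1, h2]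

/-- Both squared norms equal `⟨x, T* T x⟩`. -/
lemma norm_abs_apply (T : H →L[ℂ] H) (x : H) : ‖CFC.abs T x‖ = ‖T x‖ := by
  have hs : (CFC.abs T).adjoint = CFC.abs T := by
    rw [← ContinuousLinearMap.star_eq_adjoint]
    exact (IsSelfAdjoint.of_nonneg (CFC.abs_nonneg T)).star_eq
  have h1 : ⟪CFC.abs T x, CFC.abs T x⟫_ℂ = ⟪T x, T x⟫_ℂ := by
    rw [← ContinuousLinearMap.adjoint_inner_right, hs, ← ContinuousLinearMap.adjoint_inner_right,
      ← ContinuousLinearMap.star_eq_adjoint]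
    exact congrArg (fun S : H →L[ℂ] H => ⟪x, S x⟫_ℂ) (CFC.abs_mul_abs T)
  rw [inner_self_eq_ofReal, inner_self_eq_ofReal] at h1
  exact (sq_eq_sq₀ (norm_nonneg _) (norm_nonneg _)).1 (Complex.ofReal_injective h1)

/-- Polar decomposition, with a contraction as the polar part. -/
lemma exists_polar (T : H →L[ℂ] H) :
    ∃ W : H →L[ℂ] H, ‖W‖ ≤ 1 ∧ T = W * CFC.abs T ∧ CFC.abs T = W.adjoint * T := by
  obtain ⟨W, hW, h⟩ := exists_contraction_factor fun x => (norm_abs_apply T x).symm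
  refine ⟨W, hW, h, ?_⟩
  ext x
  set v := CFC.abs T x with hv
  have hTx : T x = W v := congrArg (fun S : H →L[ℂ] H => S x) h
  -- `W` preserves the norm of `v` and `W*` is a contraction, so expanding `‖v - W* W v‖²` gives at
  -- most `‖v‖² - 2‖v‖² + ‖v‖² = 0`.
  have hWv : ‖W v‖ = ‖v‖ := by rw [← hTx, hv, norm_abs_apply]
  have h1 : ‖W.adjoint (W v)‖ ≤ ‖v‖ := by
    refine (W.adjoint.le_of_opNorm_le (c := 1) (by simpa using hW) _).trans ?_
    rw [one_mul, hWv]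
  have h2 : ⟪v, W.adjoint (W v)⟫_ℂ = (‖v‖ : ℂ) ^ 2 := by
    rw [ContinuousLinearMap.adjoint_inner_right, inner_self_eq_norm_sq_to_K, hWv]; rfl
  have h3 := norm_sub_sq (𝕜 := ℂ) v (W.adjoint (W v))
  rw [h2] at h3
  have h4 : RCLike.re ((‖v‖ : ℂ) ^ 2) = ‖v‖ ^ 2 := by norm_cast
  rw [h4] at h3
  have h5 : ‖v - W.adjoint (W v)‖ ^ 2 ≤ 0 := by
    have := pow_le_pow_left₀ (norm_nonneg _) h1 2
    linarith
  have h6 : ‖v - W.adjoint (W v)‖ = 0 := by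
    nlinarith [norm_nonneg (v - W.adjoint (W v))]
  change v = W.adjoint (T x)
  rw [hTx]
  exact sub_eq_zero.1 (norm_eq_zero.1 h6)

/-- Applied to `|T|`, this turns the trace-class condition on `T` into the Hilbert–Schmidt condition
on `√|T|`. -/
lemma inner_eq_norm_sqrt_sq {T : H →L[ℂ] H} (hT : 0 ≤ T) (x : H) :
    ⟪x, T x⟫_ℂ = ((‖CFC.sqrt T x‖ ^ 2 : ℝ) : ℂ) := by
  have hs : (CFC.sqrt T).adjoint = CFC.sqrt T := by
    rw [← ContinuousLinearMap.star_eq_adjoint]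
    exact (IsSelfAdjoint.of_nonneg (CFC.sqrt_nonneg T)).star_eq
  have h1 : ⟪x, T x⟫_ℂ = ⟪CFC.sqrt T x, CFC.sqrt T x⟫_ℂ := by
    rw [← ContinuousLinearMap.adjoint_inner_right, hs]
    exact congrArg (fun S : H →L[ℂ] H => ⟪x, S x⟫_ℂ) (CFC.sqrt_mul_sqrt_self T hT).symm
  rw [h1, inner_self_eq_ofReal]

/-! ### Hilbert–Schmidt operators and adjoints. -/

section HilbertSchmidt

variable (e : HilbertBasis ι ℂ H)

/-- The adjoint of a Hilbert–Schmidt operator is Hilbert–Schmidt. -/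
lemma summable_norm_adjoint_sq {R : H →L[ℂ] H} (hR : Summable fun i => ‖R (e i)‖ ^ 2) :
    Summable fun i => ‖R.adjoint (e i)‖ ^ 2 := by
  -- The squared matrix entries are summed in the other order.
  have h := (summable_prod_norm_inner_sq e hR).prod_symm
  refine ((summable_prod_of_nonneg fun p => sq_nonneg _).1 h).2.congr fun j => ?_
  rw [← (hasSum_norm_inner_sq e _).tsum_eq]
  refine tsum_congr fun i => ?_
  simp only [Prod.swap_prod_mk]
  rw [ContinuousLinearMap.adjoint_inner_right, norm_inner_symm]

/-- Symmetry of the Hilbert–Schmidt inner product under taking adjoints. -/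
lemma tsum_inner_adjoint {R S : H →L[ℂ] H} (hR : Summable fun i => ‖R (e i)‖ ^ 2)
    (hS : Summable fun i => ‖S (e i)‖ ^ 2) :
    ∑' i, ⟪R (e i), S (e i)⟫_ℂ = ∑' i, ⟪S.adjoint (e i), R.adjoint (e i)⟫_ℂ := by
  let g : ι → ι → ℂ := fun i j => ⟪R (e i), e j⟫_ℂ * ⟪e j, S (e i)⟫_ℂ
  -- Absolute convergence of the double series, from `ab ≤ a² + b²`, justifies the interchange of
  -- sums.
  have hsum : Summable (Function.uncurry g) := by
    refine Summable.of_norm_bounded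
      ((summable_prod_norm_inner_sq e hR).add (summable_prod_norm_inner_sq e hS)) fun p => ?_
    change ‖⟪R (e p.1), e p.2⟫_ℂ * ⟪e p.2, S (e p.1)⟫_ℂ‖ ≤ _
    rw [norm_mul, norm_inner_symm]
    exact mul_le_sq_add_sq _ _
  have h1 : ∀ i, ⟪R (e i), S (e i)⟫_ℂ = ∑' j, g i j := fun i =>
    (e.tsum_inner_mul_inner _ _).symm
  have h2 : ∀ j, ⟪S.adjoint (e j), R.adjoint (e j)⟫_ℂ = ∑' i, g i j := by
    intro j
    rw [← e.tsum_inner_mul_inner]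
    refine tsum_congr fun i => ?_
    rw [ContinuousLinearMap.adjoint_inner_left, ContinuousLinearMap.adjoint_inner_right,
      mul_comm]
  rw [tsum_congr h1, tsum_congr h2]
  exact hsum.tsum_comm.symm

end HilbertSchmidt

/-- Evaluation against a trace-class operator is an absolutely convergent series of matrix
elements. -/
lemma TraceClass.exists_trace_mul_eq (Ω : TraceClass H) :
    ∃ x y : basisIndex H → H, (Summable fun i => ‖x i‖ * ‖y i‖) ∧
      ∀ A : H →L[ℂ] H, trace (Ω.1 * A) = ∑' i, ⟪x i, A (y i)⟫_ℂ := by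
  obtain ⟨W, hW, hT, -⟩ := exists_polar Ω.1
  set e := basis H
  set P := CFC.sqrt (CFC.abs Ω.1) with hP
  have hPP : P * P = CFC.abs Ω.1 := CFC.sqrt_mul_sqrt_self _ (CFC.abs_nonneg _)
  have hPa : P.adjoint = P := by
    rw [← ContinuousLinearMap.star_eq_adjoint]
    exact (IsSelfAdjoint.of_nonneg (CFC.sqrt_nonneg _)).star_eq
  have hPs : Summable fun i => ‖P (e i)‖ ^ 2 := by
    have h := Ω.2
    rw [IsTraceClass] at h
    simp_rw [inner_eq_norm_sqrt_sq (CFC.abs_nonneg Ω.1)] at h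
    exact Complex.summable_ofReal.1 h
  have hle : ∀ i, ‖(W * P) (e i)‖ ≤ ‖P (e i)‖ := fun i => by
    simpa using W.le_of_opNorm_le hW (P (e i))
  refine ⟨fun i => P (e i), fun i => (W * P) (e i), ?_, fun A => ?_⟩
  · refine Summable.of_nonneg_of_le (fun _ => by positivity) (fun i => ?_) hPs
    rw [sq]
    gcongr
    exact hle i
  · have hR : Summable fun i => ‖(W * P).adjoint (e i)‖ ^ 2 :=
      summable_norm_adjoint_sq e (summable_norm_comp_sq hPs W)
    have hadj : (A.adjoint * P).adjoint = P * A := by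
      rw [← ContinuousLinearMap.star_eq_adjoint, star_mul, ContinuousLinearMap.star_eq_adjoint,
        ContinuousLinearMap.star_eq_adjoint, hPa, ContinuousLinearMap.adjoint_adjoint]
    -- `P A` is the adjoint of the Hilbert–Schmidt operator `A* P`.
    have hS : Summable fun i => ‖(P * A) (e i)‖ ^ 2 := by
      rw [← hadj]
      exact summable_norm_adjoint_sq e (summable_norm_comp_sq hPs A.adjoint)
    -- Cyclicity of the trace for the Hilbert–Schmidt factors `W P` and `P A`: it turns `∑ ⟨(W P)*
    -- eᵢ, P A eᵢ⟩` into `∑ ⟨A* P eᵢ, W P eᵢ⟩`.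
    have h := tsum_inner_adjoint e hR hS
    rw [← hadj, ContinuousLinearMap.adjoint_adjoint, ContinuousLinearMap.adjoint_adjoint,
      hadj] at h
    have h1 : ∀ i, ⟪e i, (Ω.1 * A) (e i)⟫_ℂ = ⟪(W * P).adjoint (e i), (P * A) (e i)⟫_ℂ := by
      intro i
      rw [ContinuousLinearMap.adjoint_inner_left, hT, ← hPP]
      rfl
    rw [trace]
    simp_rw [e] at h1
    rw [tsum_congr h1]
    refine h.trans (tsum_congr fun i => ?_)
    exact ContinuousLinearMap.adjoint_inner_left A _ _

/-- The defining sum is Parseval's identity for `η` and `T ξ`, so any bounded `T` is allowed. -/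
lemma trace_mul_rankOne (T : H →L[ℂ] H) (ξ η : H) :
    trace (T * InnerProductSpace.rankOne ℂ ξ η) = ⟪η, T ξ⟫_ℂ := by
  rw [← (basis H).tsum_inner_mul_inner]
  refine tsum_congr fun i => ?_
  simp

/-- The trace pairing separates trace-class operators. -/
lemma TraceClass.ext_trace {Ω Θ : TraceClass H}
    (h : ∀ A : H →L[ℂ] H, trace (Ω.1 * A) = trace (Θ.1 * A)) : Ω = Θ := by
  refine Subtype.ext (ContinuousLinearMap.ext fun ξ => ext_inner_left ℂ fun η => ?_)
  rw [← trace_mul_rankOne, h, trace_mul_rankOne]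

/-- The sum is `P_F W*`, with `P_F` the projection onto the span of the `eᵢ`, `i ∈ F`; Bessel's
inequality bounds it. -/
lemma norm_sum_rankOne_le {e : ι → H} (he : Orthonormal ℂ e) (W : H →L[ℂ] H) (hW : ‖W‖ ≤ 1)
    (F : Finset ι) : ‖∑ i ∈ F, InnerProductSpace.rankOne ℂ (e i) (W (e i))‖ ≤ 1 := by
  refine ContinuousLinearMap.opNorm_le_bound _ zero_le_one fun x => ?_
  have h1 : (∑ i ∈ F, InnerProductSpace.rankOne ℂ (e i) (W (e i))) x =
      ∑ i ∈ F, ⟪e i, W.adjoint x⟫_ℂ • e i := by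
    rw [sum_apply]
    exact Finset.sum_congr rfl fun i _ => by
      rw [InnerProductSpace.rankOne_apply, ContinuousLinearMap.adjoint_inner_right]
  have h2 : ‖∑ i ∈ F, ⟪e i, W.adjoint x⟫_ℂ • e i‖ ^ 2 =
      ∑ i ∈ F, ‖⟪e i, W.adjoint x⟫_ℂ‖ ^ 2 := by
    have := he.inner_sum (fun i => ⟪e i, W.adjoint x⟫_ℂ) (fun i => ⟪e i, W.adjoint x⟫_ℂ) F
    simp_rw [Complex.conj_mul'] at this
    rw [inner_self_eq_ofReal] at this
    refine Complex.ofReal_injective (this.trans ?_)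
    push_cast
    rfl
  have h3 : ‖W.adjoint x‖ ≤ 1 * ‖x‖ := W.adjoint.le_of_opNorm_le (by simpa using hW) x
  rw [h1]
  refine le_trans ?_ h3
  refine (sq_le_sq₀ (norm_nonneg _) (norm_nonneg _)).1 ?_
  rw [h2]
  exact he.sum_inner_products_le _

/-- A bounded functional on `B(H)` that is continuous along the truncations `A P_F`, for `P_F` the
projections onto finitely many basis vectors, is given by a trace-class operator. -/
lemma exists_traceClass_of_functional (φ : (H →L[ℂ] H) →L[ℂ] ℂ)
    (hφ : ∀ A : H →L[ℂ] H, Tendsto (fun F : Finset (basisIndex H) =>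
      φ (∑ i ∈ F, InnerProductSpace.rankOne ℂ (A (basis H i)) (basis H i))) atTop (𝓝 (φ A))) :
    ∃ T : TraceClass H, ∀ A : H →L[ℂ] H, trace (T.1 * A) = φ A := by
  -- The form `(η, ξ) ↦ φ(|ξ⟩⟨η|)`; its Riesz representation yields `T`.
  let B : H →L⋆[ℂ] H →L[ℂ] ℂ :=
    (ContinuousLinearMap.compL ℂ H (H →L[ℂ] H) ℂ φ).comp
      (InnerProductSpace.rankOne ℂ (E := H) (F := H)).flip
  let T : H →L[ℂ] H := (InnerProductSpace.continuousLinearMapOfBilin B).adjoint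
  have hT : ∀ η ξ, ⟪η, T ξ⟫_ℂ = φ (InnerProductSpace.rankOne ℂ ξ η) := by
    intro η ξ
    rw [ContinuousLinearMap.adjoint_inner_right,
      InnerProductSpace.continuousLinearMapOfBilin_apply]
    rfl
  have htc : IsTraceClass T := by
    obtain ⟨W, hW, -, habs⟩ := exists_polar T
    rw [IsTraceClass]
    simp_rw [inner_eq_norm_sqrt_sq (CFC.abs_nonneg T)]
    refine Complex.summable_ofReal.2
      (summable_of_sum_le (c := ‖φ‖) (fun _ => by positivity) fun F => ?_)
    -- Since `|T| = W* T`, the partial sums of `tr |T|` are values of `φ` on operators of norm at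
    -- most one, hence bounded by `‖φ‖`.
    have h1 : ((∑ i ∈ F, ‖CFC.sqrt (CFC.abs T) (basis H i)‖ ^ 2 : ℝ) : ℂ) =
        φ (∑ i ∈ F, InnerProductSpace.rankOne ℂ (basis H i) (W (basis H i))) := by
      rw [map_sum, Complex.ofReal_sum]
      refine Finset.sum_congr rfl fun i _ => ?_
      rw [← inner_eq_norm_sqrt_sq (CFC.abs_nonneg T), ← hT]
      conv_lhs => rw [habs]
      exact ContinuousLinearMap.adjoint_inner_right W _ _
    have h2 := φ.le_opNorm_of_le (norm_sum_rankOne_le (basis H).orthonormal W hW F)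
    rw [← h1, Complex.norm_real, mul_one] at h2
    exact (le_abs_self _).trans h2
  refine ⟨⟨T, htc⟩, fun A => HasSum.tsum_eq ?_⟩
  -- The partial sums of `tr[T A]` are the values of `φ` on the truncations `A P_F`.
  refine (hφ A).congr fun F => ?_
  rw [map_sum]
  exact Finset.sum_congr rfl fun i _ => (hT _ _).symm

end OperatorTheory

/-! ### Countability of orthonormal bases. -/

section Basis

variable (H : Type*) [NormedAddCommGroup H] [InnerProductSpace ℂ H] [CompleteSpace H]

/-- Distinct basis vectors are `√2` apart, so their balls of radius `1/2` are disjoint, and a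
separable space has only countably many disjoint nonempty open sets. -/
lemma countable_basisIndex [TopologicalSpace.SeparableSpace H] : Countable (basisIndex H) := by
  have hd : Pairwise fun i j : basisIndex H =>
      Disjoint (Metric.ball (basis H i) (1 / 2)) (Metric.ball (basis H j) (1 / 2)) := by
    intro i j hij
    refine Metric.ball_disjoint_ball ?_
    have h := (basis H).orthonormal
    have h1 := norm_sub_sq (𝕜 := ℂ) (basis H i) (basis H j)
    rw [h.2 hij, h.1, h.1] at h1
    rw [dist_eq_norm]
    simp only [map_zero] at h1
    nlinarith [norm_nonneg (basis H i - basis H j)]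
  exact hd.countable_of_isOpen_disjoint (fun _ => Metric.isOpen_ball)
    fun i => ⟨basis H i, Metric.mem_ball_self (by norm_num)⟩

end Basis

/-! ### Restriction along a pure state. -/

section Restriction

variable {HR HS : Type*} [NormedAddCommGroup HR] [InnerProductSpace ℂ HR] [CompleteSpace HR]
  [NormedAddCommGroup HS] [InnerProductSpace ℂ HS] [CompleteSpace HS]

lemma sqrt_ketbra {ξ : HR} (hξ : ‖ξ‖ = 1) : CFC.sqrt (ketbra ξ) = ketbra ξ := by
  refine CFC.sqrt_unique ?_ (ketbra_nonneg ξ)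
  ext x
  simp [ketbra, hξ]

/-- The restriction map of a pure state is compression to the corresponding slice. -/
lemma restrictionMap_pureState {ξ : HR} (hξ : ‖ξ‖ = 1)
    (A : Composite HR HS →L[ℂ] Composite HR HS) :
    restrictionMap (pureState ξ hξ) A = (attach ξ).adjoint ∘L A ∘L attach ξ := by
  have hs : ∀ c : ℂ, attach (HS := HS) (c • ξ) = c • attach ξ := fun c => by
    ext η
    simp [attach]
  -- As `√ω eᵢ = ⟨ξ, eᵢ⟩ ξ`, all terms are multiples of one operator, with weights `|⟨eᵢ, ξ⟩|²` that
  -- sum to `1` by Parseval.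
  have h1 : ∀ i, (attach (CFC.sqrt (pureState ξ hξ).op (basis HR i))).adjoint ∘L A ∘L
      attach (CFC.sqrt (pureState ξ hξ).op (basis HR i)) =
      ((‖⟪basis HR i, ξ⟫_ℂ‖ ^ 2 : ℝ) : ℂ) • ((attach ξ).adjoint ∘L A ∘L attach (HS := HS) ξ) := by
    intro i
    have h2 : CFC.sqrt (pureState ξ hξ).op (basis HR i) = ⟪ξ, basis HR i⟫_ℂ • ξ := by
      rw [show (pureState ξ hξ).op = ketbra ξ from rfl, sqrt_ketbra hξ]
      rfl
    rw [h2, hs, map_smulₛₗ, ContinuousLinearMap.comp_smul, ContinuousLinearMap.smul_comp,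
      ContinuousLinearMap.comp_smul, smul_smul, norm_inner_symm]
    congr 1
    rw [Complex.conj_mul']
    push_cast
    rfl
  refine (tsum_congr h1).trans (HasSum.tsum_eq ?_)
  have h3 := (Complex.hasSum_ofReal.2 (hasSum_norm_inner_sq (basis HR) ξ)).smul_const
    ((attach ξ).adjoint ∘L A ∘L attach (HS := HS) ξ)
  simpa [hξ] using h3

end Restriction

/-! ### Conditioned relativization: the localizing limit and the predual. -/

section Relativization

variable {G : Type*} [Group G] [TopologicalSpace G]

/-- For a projective representation `U(1)` is only a phase: `U(1) = c U(1)²` forces `c U(1) = 1`,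
and phases cancel under conjugation. -/
lemma ProjectiveRep.conj_one {H : Type*} [NormedAddCommGroup H] [InnerProductSpace ℂ H]
    [CompleteSpace H] (U : ProjectiveRep G H) (A : H →L[ℂ] H) : U.conj 1 A = A := by
  obtain ⟨c, hc, h⟩ := U.map_mul 1 1
  set V : H →L[ℂ] H := (U.toFun 1 : H →L[ℂ] H) with hV
  have hV1 : V * star V = 1 := Unitary.mul_star_self_of_mem (U.toFun 1).2
  rw [mul_one] at h
  have h1 : c • V = 1 := by
    calc c • V = c • (V * (V * star V)) := by rw [hV1, mul_one]
      _ = (c • (V * V)) * star V := by rw [smul_mul_assoc, mul_assoc]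
      _ = 1 := by rw [← h, hV1]
  have hcc : c * star c = 1 := by
    rw [mul_comm]
    change (starRingEnd ℂ) c * c = 1
    rw [Complex.conj_mul', hc]; simp
  calc V * A * star V = (c * star c) • (V * A * star V) := by rw [hcc, one_smul]
    _ = (c • V) * A * star (c • V) := by
      rw [star_smul, smul_mul_assoc, smul_mul_assoc, mul_smul_comm, smul_smul]
    _ = A := by rw [h1, star_one, one_mul, mul_one]

lemma norm_inner_conj_le {H : Type*} [NormedAddCommGroup H] [InnerProductSpace ℂ H]
    [CompleteSpace H] (U : ProjectiveRep G H) (A : H →L[ℂ] H) (η η' : H) (g : G) :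
    ‖⟪η, U.conj g A η'⟫_ℂ‖ ≤ ‖A‖ * (‖η‖ * ‖η'‖) := by
  refine (norm_inner_le_norm _ _).trans ?_
  have := (U.conj g A).le_of_opNorm_le (U.norm_conj_le g A) η'
  calc _ ≤ ‖η‖ * (‖A‖ * ‖η'‖) := by gcongr
    _ = _ := by ring

variable [MeasurableSpace G]

/-- Uniformity in `μ` lets one summable bound dominate the trace series of every state at once. -/
lemma norm_integral_inner_conj_le {H : Type*} [NormedAddCommGroup H] [InnerProductSpace ℂ H]
    [CompleteSpace H] (U : ProjectiveRep G H) (A : H →L[ℂ] H) (η η' : H)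
    (μ : Measure G) [IsProbabilityMeasure μ] :
    ‖∫ g, ⟪η, U.conj g A η'⟫_ℂ ∂μ‖ ≤ ‖A‖ * (‖η‖ * ‖η'‖) := by
  simpa using norm_integral_le_of_norm_le_const (μ := μ)
    (Eventually.of_forall (norm_inner_conj_le U A η η'))

variable [BorelSpace G]
variable {HR HS : Type*} [NormedAddCommGroup HR] [InnerProductSpace ℂ HR] [CompleteSpace HR]
  [NormedAddCommGroup HS] [InnerProductSpace ℂ HS] [CompleteSpace HS]

lemma inner_conditionedRelativization (R : PrincipalFrame G HR) (U : ProjectiveRep G HS)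
    {ω : DensityOperator HR} (hω : ω.IsPure) (A : HS →L[ℂ] HS) (η η' : HS) :
    ⟪η, conditionedRelativization R U ω A η'⟫_ℂ =
      ∫ g, ⟪η, U.conj g A η'⟫_ℂ ∂(R.povm.bornMeasure ω : Measure G) := by
  obtain ⟨ξ, hξ, rfl⟩ := hω
  rw [← relativization_spec R U A ξ hξ, conditionedRelativization, restrictionMap_pureState,
    ContinuousLinearMap.comp_apply, ContinuousLinearMap.comp_apply,
    ContinuousLinearMap.adjoint_inner_right, attach_apply, attach_apply]

lemma integrable_inner_conj (U : ProjectiveRep G HS) (A : HS →L[ℂ] HS) (η η' : HS)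
    (μ : Measure G) [IsFiniteMeasure μ] : Integrable (fun g => ⟪η, U.conj g A η'⟫_ℂ) μ :=
  Integrable.of_bound (U.continuous_inner_conj A η η').measurable.aestronglyMeasurable _
    (Eventually.of_forall (norm_inner_conj_le U A η η'))

/-- Conditioned relativization along a localizing sequence converges ultraweakly to the
identity. -/
lemma ultraweakTendsto_conditionedRelativization (R : PrincipalFrame G HR)
    (U : ProjectiveRep G HS) {ω : ℕ → DensityOperator HR}
    (hω : R.povm.IsLocalizingSequence 1 ω) (A : HS →L[ℂ] HS) :
    UltraweakTendsto (fun n => conditionedRelativization R U (ω n) A) A := by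
  intro Ω
  obtain ⟨x, y, hxy, h⟩ := Ω.exists_trace_mul_eq
  simp_rw [h, inner_conditionedRelativization R U (hω.1 _)]
  refine tendsto_tsum_of_dominated_convergence (hxy.mul_left ‖A‖) (fun k => ?_)
    (Eventually.of_forall fun n k => norm_integral_inner_conj_le U A _ _ _)
  -- Weak convergence is tested on the bounded continuous function `g ↦ ⟨x k, (g.A) (y k)⟩`.
  have h1 := (ProbabilityMeasure.tendsto_iff_forall_integral_rclike_tendsto ℂ).1 hω.2
    (BoundedContinuousFunction.ofNormedAddCommGroup _ (U.continuous_inner_conj A (x k) (y k)) _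
      (norm_inner_conj_le U A (x k) (y k)))
  have h2 : ∫ g, ⟪x k, U.conj g A (y k)⟫_ℂ ∂(diracProba (1 : G) : Measure G) =
      ⟪x k, A (y k)⟫_ℂ := by
    rw [diracProba, ProbabilityMeasure.coe_mk, integral_dirac' _ _
      (U.continuous_inner_conj A (x k) (y k)).measurable.stronglyMeasurable, U.conj_one]
  rw [← h2]
  exact h1

/-- Truncating to finitely many basis vectors converges strongly. -/
lemma tendsto_sum_rankOne {H : Type*} [NormedAddCommGroup H] [InnerProductSpace ℂ H]
    [CompleteSpace H] (A : H →L[ℂ] H) (v : H) :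
    Tendsto (fun F : Finset (basisIndex H) =>
      (∑ i ∈ F, InnerProductSpace.rankOne ℂ (A (basis H i)) (basis H i)) v) atTop (𝓝 (A v)) := by
  have h := ((basis H).hasSum_repr v).mapL A
  refine h.congr fun F => ?_
  rw [sum_apply]
  refine Finset.sum_congr rfl fun i _ => ?_
  change A ((basis H).repr v i • basis H i) = ⟪basis H i, v⟫_ℂ • A (basis H i)
  rw [map_smul, (basis H).repr_apply_apply]

lemma norm_sum_rankOne_comp_le {H : Type*} [NormedAddCommGroup H] [InnerProductSpace ℂ H]
    [CompleteSpace H] (A : H →L[ℂ] H) (F : Finset (basisIndex H)) :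
    ‖∑ i ∈ F, InnerProductSpace.rankOne ℂ (A (basis H i)) (basis H i)‖ ≤ ‖A‖ := by
  have h : ∑ i ∈ F, InnerProductSpace.rankOne ℂ (A (basis H i)) (basis H i) =
      A * ∑ i ∈ F, InnerProductSpace.rankOne ℂ (basis H i) ((1 : H →L[ℂ] H) (basis H i)) := by
    rw [Finset.mul_sum]
    exact Finset.sum_congr rfl fun i _ => by ext v; simp
  rw [h]
  refine (norm_mul_le _ _).trans (mul_le_of_le_one_right (norm_nonneg _) ?_)
  exact norm_sum_rankOne_le (basis H).orthonormal 1 ContinuousLinearMap.norm_id_le F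

/-- For fixed `g` the matrix elements of `g.(A P_F)` converge to those of `g.A`. Dominated
convergence, first under the integral and then in the trace series, carries this to the functional
`A ↦ tr[Ω ¥_ω(A)]`. -/
lemma exists_predual [TopologicalSpace.SeparableSpace HS] (R : PrincipalFrame G HR)
    (U : ProjectiveRep G HS) {ω : DensityOperator HR} (hω : ω.IsPure) (Ω : TraceClass HS) :
    ∃ T : TraceClass HS, ∀ A : HS →L[ℂ] HS,
      trace (T.1 * A) = trace (Ω.1 * conditionedRelativization R U ω A) := by
  obtain ⟨x, y, hxy, h⟩ := Ω.exists_trace_mul_eq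
  set μ : Measure G := (R.povm.bornMeasure ω : Measure G) with hμ
  -- Linearity in `A` is read off from these integrals, since `relativization` chooses an operator
  -- for each `A` separately.
  let I : (HS →L[ℂ] HS) → basisIndex HS → ℂ := fun A k =>
    ∫ g, ⟪x k, U.conj g A (y k)⟫_ℂ ∂μ
  have hI : ∀ A k, ‖I A k‖ ≤ ‖A‖ * (‖x k‖ * ‖y k‖) := fun A k =>
    norm_integral_inner_conj_le U A _ _ μ
  have hsum : ∀ A, Summable (I A) := fun A =>
    Summable.of_norm_bounded (hxy.mul_left ‖A‖) (hI A)
  have htr : ∀ A, trace (Ω.1 * conditionedRelativization R U ω A) = ∑' k, I A k := fun A => by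
    simp_rw [h, inner_conditionedRelativization R U hω, I, hμ]
  have hadd : ∀ A B, ∑' k, I (A + B) k = ∑' k, I A k + ∑' k, I B k := fun A B => by
    rw [← (hsum A).tsum_add (hsum B)]
    refine tsum_congr fun k => ?_
    simp only [I]
    rw [← integral_add (integrable_inner_conj U A _ _ μ) (integrable_inner_conj U B _ _ μ)]
    refine integral_congr_ae (Eventually.of_forall fun g => ?_)
    simp [ProjectiveRep.conj, mul_add, add_mul]
  have hsmul : ∀ (c : ℂ) A, ∑' k, I (c • A) k = c * ∑' k, I A k := fun c A => by
    rw [← tsum_mul_left]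
    refine tsum_congr fun k => ?_
    simp only [I]
    rw [← integral_const_mul]
    refine integral_congr_ae (Eventually.of_forall fun g => ?_)
    simp [ProjectiveRep.conj]
  let φ : (HS →L[ℂ] HS) →L[ℂ] ℂ := LinearMap.mkContinuous
    { toFun := fun A => ∑' k, I A k
      map_add' := hadd
      map_smul' := hsmul } (∑' k, ‖x k‖ * ‖y k‖) fun A => by
        refine (tsum_of_norm_bounded (hxy.mul_left ‖A‖).hasSum (hI A)).trans ?_
        rw [tsum_mul_left, mul_comm]
  obtain ⟨T, hT⟩ := exists_traceClass_of_functional φ fun A => by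
    -- Makes the filter of finite index sets countably generated, as dominated convergence for
    -- integrals requires.
    have := countable_basisIndex HS
    refine tendsto_tsum_of_dominated_convergence (hxy.mul_left ‖A‖) (fun k => ?_)
      (Eventually.of_forall fun F k => (hI _ k).trans ?_)
    · refine tendsto_integral_filter_of_dominated_convergence
        (fun _ => ‖A‖ * (‖x k‖ * ‖y k‖)) (Eventually.of_forall fun F =>
          (integrable_inner_conj U _ _ _ μ).aestronglyMeasurable)
        (Eventually.of_forall fun F => Eventually.of_forall fun g =>
          (norm_inner_conj_le U _ _ _ g).trans ?_)
        (integrable_const _) (Eventually.of_forall fun g => ?_)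
      · gcongr
        exact norm_sum_rankOne_comp_le A F
      -- Strong convergence of the truncations, evaluated at the vector `U(g)* (y k)`.
      · exact tendsto_const_nhds.inner (((U.toFun g : HS →L[ℂ] HS).continuous.tendsto _).comp
          (tendsto_sum_rankOne A ((star (U.toFun g : HS →L[ℂ] HS)) (y k))))
    · gcongr
      exact norm_sum_rankOne_comp_le A F
  exact ⟨T, fun A => (hT A).trans (htr A).symm⟩

/-- Uniqueness is settled at each `Ω` separately, so it holds among all maps, linear or not. -/
lemma existsUnique_predual [TopologicalSpace.SeparableSpace HS] (R : PrincipalFrame G HR)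
    (U : ProjectiveRep G HS) {ω : DensityOperator HR} (hω : ω.IsPure) :
    ∃! Ψ : TraceClass HS → TraceClass HS, IsPredual (conditionedRelativization R U ω) Ψ := by
  choose Ψ hΨ using exists_predual R U hω
  exact ⟨Ψ, hΨ, fun Θ hΘ => funext fun Ω =>
    TraceClass.ext_trace fun A => (hΘ Ω A).trans (hΨ Ω A).symm⟩

end Relativization

end QRF

end

theorem mainTheorem2 {G : Type*} [Group G] [TopologicalSpace G] [IsTopologicalGroup G]
    [LocallyCompactSpace G] [SecondCountableTopology G] [T2Space G]
    [MeasurableSpace G] [BorelSpace G]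
    {HR HS : Type*} [NormedAddCommGroup HR] [InnerProductSpace ℂ HR] [CompleteSpace HR]
    [TopologicalSpace.SeparableSpace HR] [NormedAddCommGroup HS] [InnerProductSpace ℂ HS]
    [CompleteSpace HS] [TopologicalSpace.SeparableSpace HS]
    (R : QRF.PrincipalFrame G HR) (hR : R.povm.IsLocalizable) (U : QRF.ProjectiveRep G HS)
    (ω : ℕ → QRF.DensityOperator HR) (hω : R.povm.IsLocalizingSequence 1 ω) :
    (∀ A : HS →L[ℂ] HS,
      QRF.UltraweakTendsto (fun n => QRF.conditionedRelativization R U (ω n) A) A) ∧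
    (∀ n, ∃! Ψ : QRF.TraceClass HS → QRF.TraceClass HS,
      QRF.IsPredual (QRF.conditionedRelativization R U (ω n)) Ψ) ∧
    (∀ Ψ : ℕ → QRF.TraceClass HS → QRF.TraceClass HS,
      (∀ n, QRF.IsPredual (QRF.conditionedRelativization R U (ω n)) (Ψ n)) →
      ∀ Ω : QRF.TraceClass HS, QRF.OperationalTendsto (fun n => Ψ n Ω) Ω) := by
  have hu := fun A => QRF.ultraweakTendsto_conditionedRelativization R U hω A
  refine ⟨hu, fun n => QRF.existsUnique_predual R U (hω.1 n), fun Ψ hΨ Ω A => ?_⟩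
  exact (hu A Ω).congr fun n => (hΨ n Ω A).symm
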